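/- Let $X, X_1, X_2, \dots$ be i.i.d. real random variables, $F$ the distribution of $X$, $S_0 = 0$, $S_n = X_1 + \dots + X_n$, and let $R_n = \max_{0 \le j \le n} S_j - S_n$ be the random walk reflected in its maximum. Write $X^+ = \max(X,0)$, $X^- = X^+ - X$. For $\kappa > 0$ and $r > 0$ let $\tau_\kappa(r) = \min\{n \ge 1 : R_n > r n^\kappa\}$, with $\min\emptyset = +\infty$. When $E|X|<\infty$ and $1/2<\kappa<1$, define $$W(y) = \int_0^y \int_{(z,\infty)} x\,F(dx)\,dz \quad (y \ge 0), \qquad I_\kappa(\lambda) = \int_1^\infty \exp\left\{-\lambda\left(\frac{y^{(2\kappa-1)/\kappa}}{W(y)}\right)^{\kappa/(1-\kappa)}\right\}\frac{dy}{y} \in [0,\infty] \quad (\lambda > 0),$$ $$\lambda_\kappa^* = \inf\{\lambda > 0 : I_\kappa(\lambda) < \infty\} \in [0,\infty] \quad (\inf\emptyset = \infty).$$ **Lemma 3.4.** Let $1/2 < \kappa < 1$, and suppose that $E|X| < \infty$, $EX = 0$, $E(X^-)^{1/\kappa} < \infty = E(X^+)^{1/\kappa}$, and $\lambda_\kappa^*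 < \infty$. Then $$\limsup_{n\to\infty} \frac{R_n}{n^\kappa} \le r_0 := 9\cdot 2^\kappa\,(6\lambda_\kappa^* 2^\kappa)^{1-\kappa} \quad \text{a.s.},$$ and $P(\tau_\kappa(r) = \infty) > 0$ for all $r > 0$ with $r \ge r_0$. -/

import Mathlib

open MeasureTheory ProbabilityTheory Filter
open scoped ENNReal

noncomputable section

namespace ReflectedWalk

/-- The random walk `S_n = X_1 + ... + X_n`, `S_0 = 0`; the steps are indexed from `0`,
so `X i` is the `(i + 1)`-st step. -/
def S {Ω : Type*} (X : ℕ → Ω → ℝ) (n : ℕ) (ω : Ω) : ℝ :=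
  ∑ i ∈ Finset.range n, X i ω

/-- The walk reflected in its maximum, `R_n = max_{0 ≤ j ≤ n} S_j - S_n`. -/
def R {Ω : Type*} (X : ℕ → Ω → ℝ) (n : ℕ) (ω : Ω) : ℝ :=
  (Finset.range (n + 1)).sup' Finset.nonempty_range_add_one (fun j => S X j ω) - S X n ω

/-- The passage time `τ_κ(r) = min {n ≥ 1 : R_n > r n ^ κ}`, with `min ∅ = ∞`. -/
def tau {Ω : Type*} (X : ℕ → Ω → ℝ) (κ r : ℝ) (ω : Ω) : ℕ∞ :=
  ⨅ (n : ℕ) (_ : 1 ≤ n ∧ r * (n : ℝ) ^ κ < R X n ω), (n : ℕ∞)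

/-- `W(y) = ∫_0^y ∫_{(z, ∞)} x F(dx) dz`, where `F` is the law of a step. -/
def W (F : Measure ℝ) (y : ℝ) : ℝ :=
  ∫ z in (0 : ℝ)..y, ∫ x in Set.Ioi z, x ∂F

/-- `I_κ(λ) = ∫_1^∞ exp (-λ (y ^ ((2κ-1)/κ) / W(y)) ^ (κ/(1-κ))) dy / y`, in `[0, ∞]`. -/
def I (F : Measure ℝ) (κ l : ℝ) : ℝ≥0∞ :=
  ∫⁻ y in Set.Ioi (1 : ℝ),
    ENNReal.ofReal
      (Real.exp (-l * (y ^ ((2 * κ - 1) / κ) / W F y) ^ (κ / (1 - κ))) / y)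

/-- `λ*_κ = inf {λ > 0 : I_κ(λ) < ∞}`, in `[0, ∞]`. -/
def lambdaStar (F : Measure ℝ) (κ : ℝ) : ℝ≥0∞ :=
  ⨅ (l : ℝ) (_ : 0 < l ∧ I F κ l < ∞), ENNReal.ofReal l

/-- `r_0 = 9 · 2 ^ κ · (6 λ*_κ 2 ^ κ) ^ (1 - κ)`, used when `λ*_κ` is finite. -/
def r0 (F : Measure ℝ) (κ : ℝ) : ℝ :=
  9 * (2 : ℝ) ^ κ * (6 * (lambdaStar F κ).toReal * (2 : ℝ) ^ κ) ^ (1 - κ)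

end ReflectedWalk

end

namespace ReflectedWalk

/-! `R_n` is the largest increment over `[j, n)`, `j ≤ n`, of the walk with steps `-X`. As `EX = 0`,
with `m = E X⁺ = E X⁻` each step splits as `(m - X⁺) + (X⁻ - m)`, and each half gets the budget
`(r/2) n^κ`. Both are controlled along dyadic times by Borel–Cantelli, through one maximal
inequality over all increments, `measure_exists_increment_gt_le`.

The steps `m - X⁺` are bounded above, and `E e^{-hX⁺}` is governed by `h² W(1/h)`. This gives an
exponential bound with a free parameter `h = 1/y`. At time `N = 2^k`, `y` is taken with `W(y)/y`
proportional to `N^{κ-1}`; the bound is then `exp(-const · N^κ / y)`. These scales grow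
geometrically, and up to constants `N^κ / y` dominates the exponent in `I_κ` on a block ending at
`y`, so `I_κ(λ) < ∞` makes the series converge (`tsum_exp_scale_ne_top`). The value of `r_0`
guarantees that a suitable `λ` exists (`exists_finite_I`).

The steps `X⁻ - m` are truncated at `N^κ` and handled by second moments; `E (X⁻)^{1/κ} < ∞` makes
that series converge for any positive budget.

For `τ = ∞`, the increments after some time `m` obey the bound with positive probability, and
independently the first `m` steps are all positive with positive probability. -/

/-- The walk with steps `ξ`, reflected at `0` and frozen once it exceeds `x`. -/
noncomputable def absorbed {Ω : Type*} (ξ : ℕ → Ω → ℝ) (x : ℝ) : ℕ → Ω → ℝ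
  | 0, _ => 0
  | n + 1, ω =>
    if x < absorbed ξ x n ω then absorbed ξ x n ω else max 0 (absorbed ξ x n ω + ξ n ω)

/-! ### Maximal inequality for increments via reflection and freezing. -/

section absorbed

variable {Ω : Type*} {ξ : ℕ → Ω → ℝ} {x : ℝ}

lemma absorbed_nonneg (n : ℕ) (ω : Ω) : 0 ≤ absorbed ξ x n ω := by
  induction n with
  | zero => simp [absorbed]
  | succ n ih =>
    rw [absorbed]
    split_ifs
    · exact ih
    · exact le_max_left _ _

lemma absorbed_le_of_succ_le {n : ℕ} {ω : Ω} (h : absorbed ξ x (n + 1) ω ≤ x) :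
    absorbed ξ x n ω ≤ x := by
  rw [absorbed] at h
  split_ifs at h with h'
  · exact h
  · exact not_lt.1 h'

lemma absorbed_le_of_le {n M : ℕ} (hn : n ≤ M) {ω : Ω} (h : absorbed ξ x M ω ≤ x) :
    absorbed ξ x n ω ≤ x := by
  induction hn with
  | refl => exact h
  | step _ ih => exact ih (absorbed_le_of_succ_le h)

/-- Until it freezes, reflection at `0` only pushes the walk up, so it dominates every increment
ending at the current time. -/
lemma sum_le_absorbed {n : ℕ} {ω : Ω} (h : absorbed ξ x n ω ≤ x) {j : ℕ} (hj : j ≤ n) :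
    ∑ i ∈ Finset.Ico j n, ξ i ω ≤ absorbed ξ x n ω := by
  induction n with
  | zero => simp [absorbed]
  | succ n ih =>
    rcases hj.lt_or_eq with hj | rfl
    · have h' := absorbed_le_of_succ_le h
      rw [Finset.sum_Ico_succ_top (Nat.lt_succ_iff.1 hj), absorbed, if_neg (not_lt.2 h')]
      exact le_max_of_le_right (add_le_add_left (ih h' (Nat.lt_succ_iff.1 hj)) _)
    · simpa using absorbed_nonneg _ _

lemma measurable_absorbed [MeasurableSpace Ω] (n : ℕ) (hξ : ∀ i < n, Measurable (ξ i)) :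
    Measurable (absorbed ξ x n) := by
  induction n with
  | zero => exact measurable_const
  | succ n ih =>
    have hQ := ih fun i hi => hξ i (hi.trans n.lt_succ_self)
    exact Measurable.ite (measurableSet_lt measurable_const hQ) hQ
      (measurable_const.max (hQ.add (hξ n n.lt_succ_self)))

lemma indepFun_absorbed [mΩ : MeasurableSpace Ω] {P : Measure Ω}
    (hξ : ∀ i, Measurable (ξ i)) (hind : iIndepFun ξ P) (n : ℕ) :
    IndepFun (absorbed ξ x n) (ξ n) P := by
  have h := indep_iSup_of_disjoint (fun i => (hξ i).comap_le) hind
    (S := Set.Iio n) (T := {n}) (by simp)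
  refine indep_of_indep_of_le_left (indep_of_indep_of_le_right h ?_) ?_
  · exact le_iSup₂_of_le (f := fun i (_ : i ∈ ({n} : Set ℕ)) =>
      MeasurableSpace.comap (ξ i) inferInstance) n rfl le_rfl
  · rw [← measurable_iff_comap_le]
    refine @measurable_absorbed Ω ξ x
      (⨆ i ∈ Set.Iio n, MeasurableSpace.comap (ξ i) inferInstance) n fun i hi => ?_
    rw [measurable_iff_comap_le]
    exact le_iSup₂_of_le (f := fun i (_ : i ∈ Set.Iio n) =>
      MeasurableSpace.comap (ξ i) inferInstance) i hi le_rfl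

/-- The new step is independent of the current position, so Fubini reduces the claim to the one-step
bound at a fixed starting point `v ≥ 0`. -/
lemma lintegral_absorbed_succ_le [MeasurableSpace Ω] {P : Measure Ω} [IsProbabilityMeasure P]
    (hξ : ∀ i, Measurable (ξ i)) (hind : iIndepFun ξ P)
    {g : ℝ → ℝ≥0∞} (hg : Measurable g) (hmax : ∀ v, g (max 0 v) ≤ g v) {a b : ℝ≥0∞}
    (ha : 1 ≤ a) (n : ℕ) (hstep : ∀ v, 0 ≤ v → ∫⁻ ω, g (v + ξ n ω) ∂P ≤ a * g v + b) :
    ∫⁻ ω, g (absorbed ξ x (n + 1) ω) ∂P ≤ a * ∫⁻ ω, g (absorbed ξ x n ω) ∂P + b := by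
  set Q := absorbed ξ x n
  have hQ : Measurable Q := measurable_absorbed n fun i _ => hξ i
  set H : ℝ × ℝ → ℝ≥0∞ := fun p => if x < p.1 then g p.1 else g (p.1 + p.2)
  have hH : Measurable H :=
    Measurable.ite (measurableSet_lt measurable_const measurable_fst) (hg.comp measurable_fst)
      (hg.comp (measurable_fst.add measurable_snd))
  calc ∫⁻ ω, g (absorbed ξ x (n + 1) ω) ∂P ≤ ∫⁻ ω, H (Q ω, ξ n ω) ∂P := by
        refine lintegral_mono fun ω => ?_
        simp only [H, absorbed]
        split_ifs
        · exact le_rfl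
        · exact hmax _
    _ = ∫⁻ p, H p ∂(P.map fun ω => (Q ω, ξ n ω)) :=
        (lintegral_map hH (hQ.prodMk (hξ n))).symm
    _ = ∫⁻ q, ∫⁻ s, H (q, s) ∂(P.map (ξ n)) ∂(P.map Q) := by
        rw [(indepFun_iff_map_prod_eq_prod_map_map hQ.aemeasurable (hξ n).aemeasurable).1
          (indepFun_absorbed hξ hind n)]
        have := Measure.isProbabilityMeasure_map (μ := P) (hξ n).aemeasurable
        exact lintegral_prod _ hH.aemeasurable
    _ = ∫⁻ ω, ∫⁻ s, H (Q ω, s) ∂(P.map (ξ n)) ∂P := by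
        have := Measure.isProbabilityMeasure_map (μ := P) (hξ n).aemeasurable
        exact lintegral_map hH.lintegral_prod_right' hQ
    _ ≤ ∫⁻ ω, (a * g (Q ω) + b) ∂P := by
        refine lintegral_mono fun ω => ?_
        rw [lintegral_map (f := fun s => H (Q ω, s)) (hH.comp measurable_prodMk_left) (hξ n)]
        by_cases h : x < Q ω
        · simp only [H, h, if_true, lintegral_const, measure_univ, mul_one]
          -- On the frozen part nothing moves; this is where `1 ≤ a` is needed.
          exact le_add_right (le_mul_of_one_le_left' ha)
        · simp only [H, h, if_false]
          exact hstep _ (absorbed_nonneg _ _)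
    _ = _ := by
        rw [lintegral_add_right _ measurable_const, lintegral_const_mul (f := fun ω => g (Q ω)) _ (hg.comp hQ)]
        simp

/-- A maximal inequality for all increments of a random walk, from one-step bounds on a
test function which does not increase under reflection at `0`. -/
theorem measure_exists_increment_gt_le [MeasurableSpace Ω] {P : Measure Ω}
    [IsProbabilityMeasure P] (hξ : ∀ i, Measurable (ξ i)) (hind : iIndepFun ξ P)
    {g : ℝ → ℝ≥0∞} (hg : Measurable g) (hmax : ∀ v, g (max 0 v) ≤ g v) {a b c : ℝ≥0∞}
    (ha : 1 ≤ a) (hstep : ∀ n v, 0 ≤ v → ∫⁻ ω, g (v + ξ n ω) ∂P ≤ a * g v + b)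
    (hc : ∀ v, x < v → c ≤ g v) {G : ℕ → ℝ≥0∞} (h0 : g 0 ≤ G 0)
    (hG : ∀ n, a * G n + b ≤ G (n + 1)) (M : ℕ) :
    c * P {ω | ∃ n ≤ M, ∃ j ≤ n, x < ∑ i ∈ Finset.Ico j n, ξ i ω} ≤ G M := by
  have key : ∀ n, ∫⁻ ω, g (absorbed ξ x n ω) ∂P ≤ G n := by
    intro n
    induction n with
    | zero => simpa [absorbed] using h0
    | succ n ih =>
      refine (lintegral_absorbed_succ_le hξ hind hg hmax ha n (hstep n)).trans (le_trans ?_ (hG n))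
      gcongr
  have hQ : Measurable (absorbed ξ x M) := measurable_absorbed M fun i _ => hξ i
  calc c * P {ω | ∃ n ≤ M, ∃ j ≤ n, x < ∑ i ∈ Finset.Ico j n, ξ i ω}
      ≤ c * P {ω | c ≤ g (absorbed ξ x M ω)} := by
        refine mul_le_mul_right (measure_mono ?_) _
        rintro ω ⟨n, hn, j, hj, h⟩
        -- Freezing turns an exceedance at any time up to `M` into one at time `M`, so Markov's
        -- inequality at the terminal time suffices.
        refine hc _ (lt_of_not_ge fun hle => ?_)
        have h1 := absorbed_le_of_le hn hle
        exact absurd (h.trans_le ((sum_le_absorbed h1 hj).trans h1)) (lt_irrefl _)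
    _ ≤ ∫⁻ ω, g (absorbed ξ x M ω) ∂P := mul_meas_ge_le_lintegral (hg.comp hQ) c
    _ ≤ G M := key M

end absorbed

/-! ### The truncated second moment `W` and the Laplace transform of `X⁺`. -/

section W

variable {F : Measure ℝ}

lemma integrable_posPart (hF : Integrable (fun x : ℝ => x) F) :
    Integrable (fun x : ℝ => max x 0) F :=
  hF.pos_part

lemma abs_min_max_le (x y : ℝ) : |min (max x 0) y| ≤ |y| := by
  rw [abs_le]
  exact ⟨le_min ((neg_nonpos.2 (abs_nonneg y)).trans (le_max_right _ _)) (neg_abs_le y),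
    (min_le_right _ _).trans (le_abs_self y)⟩

lemma integrable_posPart_mul_min (hF : Integrable (fun x : ℝ => x) F) (y : ℝ) :
    Integrable (fun x : ℝ => max x 0 * min (max x 0) y) F :=
  (integrable_posPart hF).mul_bdd (c := |y|)
    (by fun_prop) (ae_of_all _ fun x => abs_min_max_le x y)

lemma setIntegral_indicator_Iio {x y : ℝ} (hy : 0 ≤ y) :
    ∫ z in Set.Ioc 0 y, (Set.Ioi z).indicator (fun x => x) x = max x 0 * min (max x 0) y := by
  have h : (fun z : ℝ => (Set.Ioi z).indicator (fun x => x) x)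
      = (Set.Iio x).indicator fun _ => x := by
    ext z
    by_cases hz : z < x <;> simp [hz]
  rw [h, setIntegral_indicator measurableSet_Iio, setIntegral_const, smul_eq_mul]
  rcases le_or_gt x 0 with hx | hx
  · have : Set.Ioc 0 y ∩ Set.Iio x = ∅ := by
      ext z
      simp only [Set.mem_inter_iff, Set.mem_Ioc, Set.mem_Iio, Set.mem_empty_iff_false, iff_false]
      rintro ⟨⟨h1, -⟩, h2⟩
      linarith
    simp [this, max_eq_right hx]
  · rw [max_eq_left hx.le, mul_comm]
    congr 1
    rcases lt_or_ge y x with hxy | hxy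
    · have : Set.Ioc 0 y ∩ Set.Iio x = Set.Ioc 0 y :=
        Set.inter_eq_left.2 fun z hz => hz.2.trans_lt hxy
      rw [this, min_eq_right hxy.le]
      simp [hy]
    · have : Set.Ioc 0 y ∩ Set.Iio x = Set.Ioo 0 x := by
        ext z
        simp only [Set.mem_inter_iff, Set.mem_Ioc, Set.mem_Iio, Set.mem_Ioo]
        exact ⟨fun h => ⟨h.1.1, h.2⟩, fun h => ⟨⟨h.1, h.2.le.trans hxy⟩, h.2⟩⟩
      rw [this, min_eq_left hxy]
      simp [hx.le]

/-- `W(y) = E[X⁺ (X⁺ ∧ y)]`. -/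
lemma W_eq_integral [IsFiniteMeasure F] (hF : Integrable (fun x : ℝ => x) F) {y : ℝ}
    (hy : 0 ≤ y) : W F y = ∫ x, max x 0 * min (max x 0) y ∂F := by
  have hm : Measurable fun p : ℝ × ℝ => (Set.Ioi p.1).indicator (fun x => x) p.2 := by
    have : (fun p : ℝ × ℝ => (Set.Ioi p.1).indicator (fun x => x) p.2)
        = fun p : ℝ × ℝ => if p.1 < p.2 then p.2 else 0 := by
      ext p
      simp [Set.indicator_apply]
    rw [this]
    exact Measurable.ite (measurableSet_lt measurable_fst measurable_snd) measurable_snd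
      measurable_const
  have hi : Integrable (Function.uncurry fun z x : ℝ => (Set.Ioi z).indicator (fun x => x) x)
      ((volume.restrict (Set.Ioc 0 y)).prod F) := by
    refine Integrable.mono' (g := fun p => |p.2|) ?_ hm.aestronglyMeasurable
      (ae_of_all _ fun p => ?_)
    · exact hF.abs.comp_snd _
    · simp only [Function.uncurry, Set.indicator_apply]
      split_ifs <;> simp
  rw [W, intervalIntegral.integral_of_le hy]
  calc ∫ z in Set.Ioc 0 y, ∫ x in Set.Ioi z, x ∂F
      = ∫ z in Set.Ioc 0 y, ∫ x, (Set.Ioi z).indicator (fun x => x) x ∂F := by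
        simp_rw [integral_indicator measurableSet_Ioi]
    _ = ∫ x, (∫ z in Set.Ioc 0 y, (Set.Ioi z).indicator (fun x => x) x) ∂F :=
        integral_integral_swap hi
    _ = _ := by simp_rw [setIntegral_indicator_Iio hy]

variable [IsFiniteMeasure F]

lemma W_mono (hF : Integrable (fun x : ℝ => x) F) {y z : ℝ} (hy : 0 ≤ y) (hyz : y ≤ z) :
    W F y ≤ W F z := by
  rw [W_eq_integral hF hy, W_eq_integral hF (hy.trans hyz)]
  refine integral_mono (integrable_posPart_mul_min hF _) (integrable_posPart_mul_min hF _)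
    fun x => ?_
  exact mul_le_mul_of_nonneg_left (min_le_min_left _ hyz) (le_max_right _ _)

lemma W_nonneg (hF : Integrable (fun x : ℝ => x) F) {y : ℝ} (hy : 0 ≤ y) : 0 ≤ W F y := by
  simpa [W] using W_mono hF le_rfl hy

/-- `(x⁺ ∧ y) / y` decreases in `y`, hence so does `W(y) / y`. -/
lemma mul_W_le_mul_W (hF : Integrable (fun x : ℝ => x) F) {y z : ℝ} (hy : 0 < y)
    (hyz : y ≤ z) : y * W F z ≤ z * W F y := by
  rw [W_eq_integral hF hy.le, W_eq_integral hF (hy.le.trans hyz), ← integral_const_mul,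
    ← integral_const_mul]
  refine integral_mono ((integrable_posPart_mul_min hF _).const_mul _)
    ((integrable_posPart_mul_min hF _).const_mul _) fun x => ?_
  have hx : 0 ≤ max x 0 := le_max_right _ _
  have : y * min (max x 0) z ≤ z * min (max x 0) y := by
    rw [mul_min_of_nonneg _ _ (hy.le.trans hyz)]
    refine le_min ?_ ?_
    · exact (mul_le_mul_of_nonneg_left (min_le_left _ _) hy.le).trans
        (mul_le_mul_of_nonneg_right hyz hx)
    · rw [mul_comm z y]
      exact mul_le_mul_of_nonneg_left (min_le_right _ _) hy.le
  calc y * (max x 0 * min (max x 0) z) = max x 0 * (y * min (max x 0) z) := by ring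
    _ ≤ max x 0 * (z * min (max x 0) y) := mul_le_mul_of_nonneg_left this hx
    _ = _ := by ring

lemma W_div_antitone (hF : Integrable (fun x : ℝ => x) F) {y z : ℝ} (hy : 0 < y)
    (hyz : y ≤ z) : W F z / z ≤ W F y / y := by
  rw [div_le_div_iff₀ (hy.trans_le hyz) hy]
  linarith [mul_W_le_mul_W hF hy hyz]

lemma W_pos (hF : Integrable (fun x : ℝ => x) F) (hF0 : F (Set.Ioi 0) ≠ 0) {y : ℝ}
    (hy : 0 < y) : 0 < W F y := by
  rw [W_eq_integral hF hy.le, integral_pos_iff_support_of_nonneg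
    (fun x => mul_nonneg (le_max_right _ _) (le_min (le_max_right _ _) hy.le))
    (integrable_posPart_mul_min hF _)]
  refine (pos_iff_ne_zero.2 hF0).trans_le (measure_mono fun x hx => ?_)
  have hx : 0 < x := hx
  exact (mul_pos (lt_max_of_lt_left hx) (lt_min (lt_max_of_lt_left hx) hy)).ne'

lemma continuousOn_W (hF : Integrable (fun x : ℝ => x) F) : ContinuousOn (W F) (Set.Ici 0) := by
  refine LipschitzOnWith.continuousOn (K := (∫ x, max x 0 ∂F).toNNReal)
    (LipschitzOnWith.of_dist_le_mul fun y hy z hz => ?_)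
  rw [W_eq_integral hF hy, W_eq_integral hF hz, Real.dist_eq, Real.dist_eq, ← integral_sub
    (integrable_posPart_mul_min hF _) (integrable_posPart_mul_min hF _),
    Real.coe_toNNReal _ (integral_nonneg fun x => le_max_right x 0), ← integral_mul_const]
  refine (abs_integral_le_integral_abs).trans (integral_mono
    ((integrable_posPart_mul_min hF _).sub (integrable_posPart_mul_min hF _)).abs
    ((integrable_posPart hF).mul_const _) fun x => ?_)
  simp only [← mul_sub, abs_mul]
  rw [abs_of_nonneg (le_max_right x 0)]
  refine mul_le_mul_of_nonneg_left ?_ (le_max_right _ _)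
  simpa using abs_min_sub_min_le_max (max x 0) y (max x 0) z

lemma tendsto_W_div (hF : Integrable (fun x : ℝ => x) F) :
    Tendsto (fun y => W F y / y) atTop (nhds 0) := by
  have h : Tendsto (fun y : ℝ => ∫ x, max x 0 * min (max x 0) y / y ∂F) atTop
      (nhds (∫ _, (0 : ℝ) ∂F)) := by
    refine tendsto_integral_filter_of_dominated_convergence (fun x => max x 0)
      (Eventually.of_forall fun y => ((integrable_posPart_mul_min hF y).div_const y).1) ?_
      (integrable_posPart hF) (ae_of_all _ fun x => ?_)
    · filter_upwards [eventually_gt_atTop 0] with y hy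
      refine ae_of_all _ fun x => ?_
      have hx := le_max_right x 0
      rw [Real.norm_of_nonneg (div_nonneg (mul_nonneg hx (le_min hx hy.le)) hy.le),
        div_le_iff₀ hy]
      exact mul_le_mul_of_nonneg_left (min_le_right _ _) hx
    · refine (tendsto_const_nhds.div_atTop tendsto_id : Tendsto
        (fun y : ℝ => max x 0 * max x 0 / y) atTop (nhds 0)).congr' ?_
      filter_upwards [eventually_ge_atTop (max x 0)] with y hy
      rw [min_eq_left hy]
  rw [integral_zero] at h
  refine h.congr' ?_
  filter_upwards [eventually_ge_atTop 0] with y hy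
  rw [integral_div, W_eq_integral hF hy]

/-- The remainder `v (v ∧ 1)` is chosen so that, at `v = h x⁺`, its expectation is exactly `h²
W(1/h)`. -/
lemma exp_neg_le_one_sub_add {v : ℝ} (hv : 0 ≤ v) : Real.exp (-v) ≤ 1 - v + v * min v 1 := by
  rcases le_total v 1 with h | h
  · have := (abs_le.1 (Real.abs_exp_sub_one_sub_id_le (x := -v)
      (by rwa [abs_neg, abs_of_nonneg hv]))).2
    rw [min_eq_left h]
    nlinarith
  · rw [min_eq_right h]
    simpa using hv

lemma integrable_exp_neg_posPart {h : ℝ} (hh : 0 < h) :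
    Integrable (fun x : ℝ => Real.exp (-(h * max x 0))) F := by
  refine Integrable.of_bound (C := 1) (by fun_prop) (ae_of_all _ fun x => ?_)
  rw [Real.norm_of_nonneg (Real.exp_pos _).le, Real.exp_le_one_iff, neg_nonpos]
  exact mul_nonneg hh.le (le_max_right _ _)

lemma integral_exp_neg_posPart_le [IsProbabilityMeasure F]
    (hF : Integrable (fun x : ℝ => x) F) {h : ℝ} (hh : 0 < h) :
    ∫ x, Real.exp (-(h * max x 0)) ∂F
      ≤ Real.exp (-(h * ∫ x, max x 0 ∂F) + h ^ 2 * W F (1 / h)) := by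
  have hp := integrable_posPart hF
  have hw := integrable_posPart_mul_min hF (1 / h)
  have h1 : Integrable (fun x : ℝ => 1 - h * max x 0) F :=
    (integrable_const _).sub (hp.const_mul _)
  calc ∫ x, Real.exp (-(h * max x 0)) ∂F
      ≤ ∫ x, (1 - h * max x 0 + h ^ 2 * (max x 0 * min (max x 0) (1 / h))) ∂F := by
        refine integral_mono (integrable_exp_neg_posPart hh) (h1.add (hw.const_mul _))
          fun x => ?_
        have e : min (h * max x 0) 1 = h * min (max x 0) (1 / h) := by
          rw [mul_min_of_nonneg _ _ hh.le, mul_one_div_cancel hh.ne']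
        refine (exp_neg_le_one_sub_add (mul_nonneg hh.le (le_max_right x 0))).trans (le_of_eq ?_)
        rw [e]
        ring
    _ = -(h * ∫ x, max x 0 ∂F) + h ^ 2 * W F (1 / h) + 1 := by
        rw [integral_add h1 (hw.const_mul _), integral_sub (integrable_const _) (hp.const_mul _),
          integral_const_mul, integral_const_mul, W_eq_integral hF (by positivity)]
        simp
        ring
    _ ≤ _ := Real.add_one_le_exp _

end W

/-- The difference of the two sides is `(A - 1)(A(e^t - t) - t)`, nonnegative because `e^t ≥ 2t`. It
trades a factor on the exponential alone for a factor on the whole test function `e^t - t`. -/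
lemma mul_exp_sub_le {A t : ℝ} (hA : 1 ≤ A) (ht : 0 ≤ t) :
    A * Real.exp t - t ≤ A ^ 2 * (Real.exp t - t) := by
  have h2 : 2 * t ≤ Real.exp t := by
    nlinarith [Real.quadratic_le_exp_of_nonneg ht, sq_nonneg (t - 1)]
  have h3 : t ≤ A * (Real.exp t - t) := by nlinarith
  nlinarith

/-- The step has mean zero, so the linear term keeps its value `hv` while the exponential gains at
most `exp(h² W(1/h))`; `mul_exp_sub_le` then doubles the exponent. -/
lemma integral_exp_step_le {F : Measure ℝ} [IsProbabilityMeasure F]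
    (hF : Integrable (fun x : ℝ => x) F) {h v : ℝ} (hh : 0 < h) (hv : 0 ≤ v) :
    Integrable (fun x : ℝ => Real.exp (h * (v + (∫ x, max x 0 ∂F - max x 0)))
        - h * (v + (∫ x, max x 0 ∂F - max x 0))) F ∧
      ∫ x, (Real.exp (h * (v + (∫ x, max x 0 ∂F - max x 0)))
        - h * (v + (∫ x, max x 0 ∂F - max x 0))) ∂F
      ≤ Real.exp (2 * (h ^ 2 * W F (1 / h))) * (Real.exp (h * v) - h * v) := by
  set m := ∫ x, max x 0 ∂F with hm
  set φ := h ^ 2 * W F (1 / h) with hφ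
  have hφ0 : 0 ≤ φ := mul_nonneg (sq_nonneg h) (W_nonneg hF (by positivity))
  have e : ∀ x : ℝ, Real.exp (h * (v + (m - max x 0)))
      = Real.exp (h * (v + m)) * Real.exp (-(h * max x 0)) := fun x => by
    rw [← Real.exp_add]
    congr 1
    ring
  have i1 := (integrable_exp_neg_posPart (F := F) hh).const_mul (Real.exp (h * (v + m)))
  have i2 : Integrable (fun x : ℝ => m - max x 0) F :=
    (integrable_const m).sub (integrable_posPart hF)
  have i3 : Integrable (fun x : ℝ => h * (v + (m - max x 0))) F :=
    ((integrable_const v).add i2).const_mul h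
  simp_rw [e]
  refine ⟨i1.sub i3, ?_⟩
  rw [integral_sub i1 i3, integral_const_mul, integral_const_mul,
    integral_add (integrable_const _) i2, integral_sub (integrable_const _)
      (integrable_posPart hF), ← hm]
  simp only [integral_const, probReal_univ, one_smul, sub_self, add_zero]
  have h1 : Real.exp (h * (v + m)) * ∫ x, Real.exp (-(h * max x 0)) ∂F
      ≤ Real.exp φ * Real.exp (h * v) := by
    refine (mul_le_mul_of_nonneg_left (integral_exp_neg_posPart_le hF hh)
      (Real.exp_pos _).le).trans (le_of_eq ?_)
    rw [← hm, ← hφ, ← Real.exp_add, ← Real.exp_add]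
    congr 1
    ring
  have h2 := mul_exp_sub_le (Real.one_le_exp hφ0) (mul_nonneg hh.le hv)
  rw [two_mul, Real.exp_add, ← sq]
  linarith

/-! ### Exponential and quadratic maximal inequalities. -/

section walk

variable {Ω : Type*} [MeasurableSpace Ω] {P : Measure Ω} [IsProbabilityMeasure P]
  {X : ℕ → Ω → ℝ}

/-- Exponential bound for the increments of the walk with steps `E X⁺ - X⁺`. -/
theorem measure_posPart_increment_gt_le (hmeas : ∀ i, Measurable (X i)) (hindep : iIndepFun X P)
    (hident : ∀ i, IdentDistrib (X i) (X 0) P P) (hint : Integrable (X 0) P)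
    {h x : ℝ} (hh : 0 < h) (M : ℕ) :
    P {ω | ∃ n ≤ M, ∃ j ≤ n,
        x < ∑ i ∈ Finset.Ico j n, (∫ x, max x 0 ∂(P.map (X 0)) - max (X i ω) 0)}
      ≤ ENNReal.ofReal
        (2 * Real.exp (2 * M * (h ^ 2 * W (P.map (X 0)) (1 / h)) - h * x)) := by
  set F := P.map (X 0) with hFdef
  have : IsProbabilityMeasure F := Measure.isProbabilityMeasure_map (hmeas 0).aemeasurable
  have hF : Integrable (fun x : ℝ => x) F :=
    (integrable_map_measure (by fun_prop) (hmeas 0).aemeasurable).2 hint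
  set m := ∫ x, max x 0 ∂F
  set φ := h ^ 2 * W F (1 / h)
  have hφ0 : 0 ≤ φ := mul_nonneg (sq_nonneg h) (W_nonneg hF (by positivity))
  have hmT : Measurable fun x : ℝ => m - max x 0 := by fun_prop
  have hexp : ∀ t : ℝ, Real.exp t / 2 ≤ Real.exp t - t := fun t => by
    rcases le_total 0 t with ht | ht
    · nlinarith [Real.quadratic_le_exp_of_nonneg ht, sq_nonneg (t - 1)]
    · nlinarith [Real.exp_pos t]
  -- Subtracting `hv` puts the minimum of the test function at `0`, so reflection cannot increase
  -- it. The loss is the factor 2 from `e^t / 2 ≤ e^t - t`.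
  have key := measure_exists_increment_gt_le (P := P) (ξ := fun i ω => m - max (X i ω) 0)
    (x := x) (g := fun v => ENNReal.ofReal (Real.exp (h * v) - h * v))
    (a := ENNReal.ofReal (Real.exp (2 * φ))) (b := 0)
    (c := ENNReal.ofReal (Real.exp (h * x) / 2))
    (G := fun n => ENNReal.ofReal (Real.exp (2 * n * φ)))
    (fun i => hmT.comp (hmeas i)) (hindep.comp (fun _ x => m - max x 0) fun _ => hmT)
    (by fun_prop) ?_ ?_ ?_ ?_ ?_ ?_ M
  · rw [mul_comm, ← ENNReal.le_div_iff_mul_le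
      (.inl (ENNReal.ofReal_pos.2 (half_pos (Real.exp_pos _))).ne') (.inl ENNReal.ofReal_ne_top),
      ENNReal.div_eq_inv_mul, mul_comm,
      ← ENNReal.ofReal_inv_of_pos (half_pos (Real.exp_pos _)),
      ← ENNReal.ofReal_mul (Real.exp_pos _).le] at key
    refine key.trans (le_of_eq ?_)
    rw [sub_eq_add_neg, Real.exp_add, Real.exp_neg]
    congr 1
    field_simp
  · intro v
    rcases le_total 0 v with hv | hv
    · rw [max_eq_right hv]
    · rw [max_eq_left hv]
      refine ENNReal.ofReal_le_ofReal ?_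
      have := Real.add_one_le_exp (h * v)
      simp only [mul_zero, Real.exp_zero]
      linarith
  · rw [ENNReal.one_le_ofReal]
    exact Real.one_le_exp (by positivity)
  · intro n v hv
    obtain ⟨hi, hle⟩ := integral_exp_step_le hF hh hv
    have hgm : Measurable fun x : ℝ => ENNReal.ofReal (Real.exp (h * (v + (m - max x 0)))
        - h * (v + (m - max x 0))) := by fun_prop
    rw [add_zero, ← ENNReal.ofReal_mul (Real.exp_pos _).le,
      ← lintegral_map hgm (hmeas n), (hident n).map_eq, ← hFdef,
      ← ofReal_integral_eq_lintegral_ofReal hi]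
    · exact ENNReal.ofReal_le_ofReal hle
    · refine ae_of_all _ fun x => ?_
      exact (half_pos (Real.exp_pos _)).le.trans (hexp _)
  · intro v hv
    refine ENNReal.ofReal_le_ofReal (le_trans ?_ (hexp _))
    gcongr
  · simp
  · intro n
    rw [add_zero, ← ENNReal.ofReal_mul (Real.exp_pos _).le, ← Real.exp_add]
    refine le_of_eq ?_
    congr 2
    push_cast
    ring

/-- Quadratic bound for the increments of the walk with centered steps `T X - E T X`. -/
theorem measure_sq_increment_gt_le (hmeas : ∀ i, Measurable (X i)) (hindep : iIndepFun X P)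
    (hident : ∀ i, IdentDistrib (X i) (X 0) P P) {T : ℝ → ℝ} (hT : Measurable T)
    (hT2 : MemLp T 2 (P.map (X 0))) {x : ℝ} (hx : 0 ≤ x) (M : ℕ) :
    ENNReal.ofReal (x ^ 2) * P {ω | ∃ n ≤ M, ∃ j ≤ n,
        x < ∑ i ∈ Finset.Ico j n, (T (X i ω) - ∫ x, T x ∂(P.map (X 0)))}
      ≤ M * ∫⁻ x, ENNReal.ofReal (T x ^ 2) ∂(P.map (X 0)) := by
  set F := P.map (X 0) with hFdef
  have : IsProbabilityMeasure F := Measure.isProbabilityMeasure_map (hmeas 0).aemeasurable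
  set m := ∫ x, T x ∂F with hm
  have hmT : Measurable fun x : ℝ => T x - m := by fun_prop
  have i1 : Integrable T F := hT2.integrable one_le_two
  have i2 : Integrable (fun x => T x ^ 2) F := hT2.integrable_sq
  refine measure_exists_increment_gt_le (P := P) (ξ := fun i ω => T (X i ω) - m)
    (x := x) (g := fun v => ENNReal.ofReal (v ^ 2)) (a := 1)
    (b := ∫⁻ x, ENNReal.ofReal (T x ^ 2) ∂F)
    (G := fun n => n * ∫⁻ x, ENNReal.ofReal (T x ^ 2) ∂F)
    (fun i => hmT.comp (hmeas i)) (hindep.comp (fun _ x => T x - m) fun _ => hmT)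
    (by fun_prop) ?_ le_rfl ?_ ?_ ?_ ?_ M
  · intro v
    refine ENNReal.ofReal_le_ofReal ?_
    rcases le_total 0 v with hv | hv
    · rw [max_eq_right hv]
    · rw [max_eq_left hv]
      simpa using sq_nonneg v
  · intro n v hv
    have e : ∀ x, (v + (T x - m)) ^ 2 = (T x ^ 2 + 2 * (v - m) * T x) + (v - m) ^ 2 := fun x => by
      ring
    have i3 : Integrable (fun x => (T x ^ 2 + 2 * (v - m) * T x) + (v - m) ^ 2) F :=
      (i2.add (i1.const_mul _)).add (integrable_const _)
    rw [← lintegral_map (f := fun x => ENNReal.ofReal ((v + (T x - m)) ^ 2)) (by fun_prop)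
      (hmeas n), (hident n).map_eq, ← hFdef]
    simp_rw [e]
    rw [← ofReal_integral_eq_lintegral_ofReal i3 (ae_of_all _ fun x => (sq_nonneg _).trans_eq (e x)),
      ← ofReal_integral_eq_lintegral_ofReal i2 (ae_of_all _ fun x => sq_nonneg _), one_mul,
      ← ENNReal.ofReal_add (sq_nonneg _) (integral_nonneg fun x => sq_nonneg _)]
    refine ENNReal.ofReal_le_ofReal ?_
    have i4 : Integrable (fun x => T x ^ 2 + 2 * (v - m) * T x) F := i2.add (i1.const_mul _)
    rw [integral_add i4 (integrable_const _),
      integral_add i2 (i1.const_mul _), integral_const_mul, ← hm]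
    simp only [integral_const, probReal_univ, one_smul]
    nlinarith [sq_nonneg m]
  · intro v hv
    exact ENNReal.ofReal_le_ofReal (pow_le_pow_left₀ hx hv.le 2)
  · simp
  · intro n
    push_cast
    rw [add_mul, one_mul, one_mul]

end walk

/-! ### Scales `y_k` adapted to `W`, and comparison with `I_κ`. -/

section scales

variable {F : Measure ℝ} [IsFiniteMeasure F] {κ c : ℝ}

lemma exists_W_div_eq (hF : Integrable (fun x : ℝ => x) F) {a : ℝ} (ha : 0 < a)
    (ha' : a ≤ W F 1) : ∃ y, 1 ≤ y ∧ W F y / y = a := by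
  obtain ⟨z, hz, hz1⟩ := (((tendsto_W_div hF).eventually_lt_const ha).and
    (eventually_ge_atTop (1 : ℝ))).exists
  have hc : ContinuousOn (fun y => W F y / y) (Set.Icc 1 z) :=
    ((continuousOn_W hF).mono fun y hy => zero_le_one.trans hy.1).div continuousOn_id
      fun y hy => (zero_lt_one.trans_le hy.1).ne'
  obtain ⟨y, hy, hya⟩ := intermediate_value_Icc' hz1 hc ⟨hz.le, by simpa using ha'⟩
  exact ⟨y, hy.1, hya⟩

/-- The shift `k₀` makes the target at most `W(1)`, so that the intermediate value theorem applies
on `[1, ∞)`. -/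
lemma exists_scales (hF : Integrable (fun x : ℝ => x) F) (hF0 : F (Set.Ioi 0) ≠ 0)
    (hκ' : κ < 1) (hc : 0 < c) : ∃ (k₀ : ℕ) (y : ℕ → ℝ), ∀ k, 1 ≤ y k ∧
      W F (y k) / y k = c * ((2 : ℝ) ^ (k₀ + k)) ^ (κ - 1) := by
  have ht : Tendsto (fun k : ℕ => c * ((2 : ℝ) ^ k) ^ (κ - 1)) atTop (nhds 0) := by
    have h1 := (tendsto_rpow_neg_atTop (y := 1 - κ) (by linarith)).comp
      (tendsto_pow_atTop_atTop_of_one_lt (one_lt_two (α := ℝ)))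
    simpa [Function.comp_def] using h1.const_mul c
  obtain ⟨k₀, hk⟩ := eventually_atTop.1 (ht.eventually_le_const (W_pos hF hF0 one_pos))
  have h := fun k => exists_W_div_eq hF (a := c * ((2 : ℝ) ^ (k₀ + k)) ^ (κ - 1))
    (by positivity) (hk _ (Nat.le_add_right _ _))
  choose y hy using h
  exact ⟨k₀, y, hy⟩

/-- Monotonicity of `W` gives `q a y = W(y) ≤ W(z) = a z`. -/
lemma mul_scale_le_scale_succ (hF : Integrable (fun x : ℝ => x) F) {q y z a : ℝ} (hq : 1 < q)
    (ha : 0 < a) (hy : 0 < y) (hz : 0 < z) (hya : W F y / y = q * a) (hza : W F z / z = a) :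
    q * y ≤ z := by
  have hyz : y ≤ z := by
    by_contra! h
    have := W_div_antitone hF hz h.le
    rw [hya, hza] at this
    linarith [mul_pos (sub_pos.2 hq) ha]
  have h1 := W_mono hF hy.le hyz
  rw [div_eq_iff hy.ne'] at hya
  rw [div_eq_iff hz.ne'] at hza
  rw [hya, hza] at h1
  exact le_of_mul_le_mul_left (by linarith) ha

/-- The left side equals `(z / W(z))^{κ/(1-κ)} / z`. The first factor is bounded at `y` since `z /
W(z)` increases, the second by `q / y`. -/
lemma exponent_le (hF : Integrable (fun x : ℝ => x) F) (hF0 : F (Set.Ioi 0) ≠ 0)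
    (hκ : 1 / 2 < κ) (hκ' : κ < 1) (hc : 0 < c) {N q y z : ℝ} (hN : 0 < N) (hq : 0 < q)
    (hz : 0 < z) (hzy : z ≤ y) (hyz : y ≤ q * z) (hy : W F y / y = c * N ^ (κ - 1)) :
    (z ^ ((2 * κ - 1) / κ) / W F z) ^ (κ / (1 - κ))
      ≤ q * c ^ (-(κ / (1 - κ))) * (N ^ κ / y) := by
  have hy0 := hz.trans_le hzy
  have hκ0 : 0 < κ := by linarith
  have hκ1 : 0 < 1 - κ := by linarith
  have hWz := W_pos hF hF0 hz
  have e1 : z ^ ((2 * κ - 1) / κ) / W F z = (z / W F z) * z ^ (-((1 - κ) / κ)) := by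
    have : (2 * κ - 1) / κ = 1 + -((1 - κ) / κ) := by
      field_simp
      ring
    rw [this, Real.rpow_add hz, Real.rpow_one]
    ring
  have e2 : (z ^ (-((1 - κ) / κ))) ^ (κ / (1 - κ)) = z⁻¹ := by
    rw [← Real.rpow_mul hz.le, ← Real.rpow_neg_one]
    congr 1
    field_simp
  have h1 : z / W F z ≤ c⁻¹ * N ^ (1 - κ) := by
    have h2 : c * N ^ (κ - 1) ≤ W F z / z := hy ▸ W_div_antitone hF hz hzy
    have h3 := inv_anti₀ (by positivity) h2
    rwa [inv_div, mul_inv, ← Real.rpow_neg hN.le, neg_sub] at h3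
  have h4 : z⁻¹ ≤ q / y := by
    rw [inv_eq_one_div, div_le_div_iff₀ hz hy0]
    linarith
  rw [e1, Real.mul_rpow (div_pos hz hWz).le (Real.rpow_pos_of_pos hz _).le, e2]
  calc (z / W F z) ^ (κ / (1 - κ)) * z⁻¹
      ≤ (c⁻¹ * N ^ (1 - κ)) ^ (κ / (1 - κ)) * (q / y) := by
        refine mul_le_mul (Real.rpow_le_rpow (div_pos hz hWz).le h1 (by positivity)) h4
          (by positivity) (by positivity)
    _ = _ := by
        rw [Real.mul_rpow (by positivity) (by positivity), ← Real.rpow_mul hN.le,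
          mul_div_cancel₀ _ hκ1.ne', Real.inv_rpow hc.le, ← Real.rpow_neg hc.le]
        ring

end scales

/-- Comparison of the integral `I_κ` with a series along a sequence of scales. -/
lemma tsum_exp_scale_ne_top {F : Measure ℝ} {κ l q : ℝ} {y E : ℕ → ℝ} (hq : 1 < q)
    (hy1 : ∀ k, 1 ≤ y k) (hy : ∀ k, q * y k ≤ y (k + 1))
    (hE : ∀ k z, 0 < z → z ≤ y k → y k ≤ q * z →
      l * (z ^ ((2 * κ - 1) / κ) / W F z) ^ (κ / (1 - κ)) ≤ E k)
    (hI : I F κ l < ∞) : ∑' k, ENNReal.ofReal (2 * Real.exp (-E k)) ≠ ∞ := by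
  have hq0 : 0 < q := zero_lt_one.trans hq
  have hy0 : ∀ k, 0 < y k := fun k => zero_lt_one.trans_le (hy1 k)
  have hmono : Monotone y := monotone_nat_of_le_succ fun k =>
    (le_mul_of_one_le_left (hy0 k).le hq.le).trans (hy k)
  -- Geometric growth of `y` makes these blocks disjoint, and each has `dz/z`-mass at least `1 -
  -- 1/q`.
  set J : ℕ → Set ℝ := fun k => Set.Ioc (y (k + 1) / q) (y (k + 1))
  have hJ : ∀ k, J k ⊆ Set.Ioc (y k) (y (k + 1)) := fun k => Set.Ioc_subset_Ioc_left
    ((le_div_iff₀ hq0).2 (by linarith [hy k]))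
  have hdisj : Pairwise (Function.onFun Disjoint J) := fun i j hij =>
    (hmono.pairwise_disjoint_on_Ioc_succ hij).mono (hJ i) (hJ j)
  -- The half absorbs the factor 2 in the series.
  set δ : ℝ := (1 - q⁻¹) / 2 with hδ
  have hδ0 : 0 < δ := half_pos (sub_pos.2 (inv_lt_one_of_one_lt₀ hq))
  have hterm : ∀ k, ENNReal.ofReal δ * ENNReal.ofReal (2 * Real.exp (-E (k + 1)))
      ≤ ∫⁻ z in J k, ENNReal.ofReal
        (Real.exp (-l * (z ^ ((2 * κ - 1) / κ) / W F z) ^ (κ / (1 - κ))) / z) := by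
    intro k
    calc ENNReal.ofReal δ * ENNReal.ofReal (2 * Real.exp (-E (k + 1)))
        = ∫⁻ _ in J k, ENNReal.ofReal (Real.exp (-E (k + 1)) / y (k + 1)) := by
          rw [setLIntegral_const, Real.volume_Ioc, ← ENNReal.ofReal_mul hδ0.le,
            ← ENNReal.ofReal_mul (div_pos (Real.exp_pos _) (hy0 _)).le]
          congr 1
          have := (hy0 (k + 1)).ne'
          rw [hδ]
          field_simp
      _ ≤ _ := by
          refine setLIntegral_mono' measurableSet_Ioc fun z hz => ENNReal.ofReal_le_ofReal ?_
          have hz0 : 0 < z := (div_pos (hy0 _) hq0).trans hz.1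
          have := hE (k + 1) z hz0 hz.2 (by
            have := (div_lt_iff₀ hq0).1 hz.1
            linarith)
          refine div_le_div₀ (Real.exp_pos _).le (Real.exp_le_exp.2 (by linarith)) hz0 hz.2
  have hsum : ENNReal.ofReal δ * ∑' k, ENNReal.ofReal (2 * Real.exp (-E (k + 1))) ≤ I F κ l := by
    rw [← ENNReal.tsum_mul_left]
    refine (ENNReal.tsum_le_tsum hterm).trans ?_
    rw [← lintegral_iUnion (fun k => measurableSet_Ioc) hdisj]
    refine lintegral_mono_set (Set.iUnion_subset fun k z hz => ?_)
    exact (hy1 k).trans_lt (hJ k hz).1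
  have hfin : ∑' k, ENNReal.ofReal (2 * Real.exp (-E (k + 1))) ≠ ∞ := fun h => by
    rw [h, ENNReal.mul_top (ENNReal.ofReal_pos.2 hδ0).ne'] at hsum
    exact absurd (hsum.trans_lt hI) (lt_irrefl _)
  -- The block ending at `y 0` may leave `(1, ∞)`; its single term is finite anyway.
  rw [tsum_eq_zero_add' ENNReal.summable]
  exact ENNReal.add_ne_top.2 ⟨ENNReal.ofReal_ne_top, hfin⟩

/-! ### Borel–Cantelli for the steps `E X⁺ - X⁺`. -/

section walk

variable {Ω : Type*} [MeasurableSpace Ω] {P : Measure Ω} [IsProbabilityMeasure P]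
  {X : ℕ → Ω → ℝ} {κ : ℝ}

/-- Almost sure control, along dyadic times, of the increments of the walk with steps
`E X⁺ - X⁺`. -/
theorem ae_eventually_posPart_increment_le (hmeas : ∀ i, Measurable (X i))
    (hindep : iIndepFun X P) (hident : ∀ i, IdentDistrib (X i) (X 0) P P)
    (hint : Integrable (X 0) P) (hpos : P.map (X 0) (Set.Ioi 0) ≠ 0)
    (hκ : 1 / 2 < κ) (hκ' : κ < 1) {r l : ℝ} (hr : 0 < r) (hl0 : 0 < l)
    (hI : I (P.map (X 0)) κ l < ∞)
    (hl : l * ((2 : ℝ) ^ (1 - κ) * (r / 8) ^ (-(κ / (1 - κ)))) ≤ r / 2) :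
    ∀ᵐ ω ∂P, ∀ᶠ k : ℕ in atTop, ∀ n ≤ 2 ^ (k + 1), ∀ j ≤ n,
      ∑ i ∈ Finset.Ico j n, (∫ x, max x 0 ∂(P.map (X 0)) - max (X i ω) 0)
        ≤ r * ((2 : ℝ) ^ k) ^ κ := by
  set F := P.map (X 0) with hFdef
  have : IsProbabilityMeasure F := Measure.isProbabilityMeasure_map (hmeas 0).aemeasurable
  have hF : Integrable (fun x : ℝ => x) F :=
    (integrable_map_measure (by fun_prop) (hmeas 0).aemeasurable).2 hint
  have hr8 : 0 < r / 8 := by positivity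
  -- With `h = 1/y`, `M = 2N` and `c = r/8`, the growth term `2M h² W(y)` is `(r/2) N^κ / y`, half
  -- of `h x = r N^κ / y`.
  obtain ⟨k₀, y, hy⟩ := exists_scales hF hpos hκ' hr8
  have hy0 : ∀ k, 0 < y k := fun k => zero_lt_one.trans_le (hy k).1
  have hq : 1 < (2 : ℝ) ^ (1 - κ) := Real.one_lt_rpow one_lt_two (by linarith)
  set m := ∫ x, max x 0 ∂F
  set A : ℕ → Set Ω := fun k => {ω | ∃ n ≤ 2 ^ (k + 1), ∃ j ≤ n,
    r * ((2 : ℝ) ^ k) ^ κ < ∑ i ∈ Finset.Ico j n, (m - max (X i ω) 0)} with hA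
  have hPA : ∀ k, P (A (k₀ + k)) ≤ ENNReal.ofReal
      (2 * Real.exp (-(r / 2 * (((2 : ℝ) ^ (k₀ + k)) ^ κ / y k)))) := by
    intro k
    refine (measure_posPart_increment_gt_le hmeas hindep hident hint
      (one_div_pos.2 (hy0 k)) _).trans_eq ?_
    congr 3
    have h1 := (div_eq_iff (hy0 k).ne').1 (hy k).2
    have h2 : ((2 : ℝ) ^ (k₀ + k)) ^ (κ - 1) * (2 : ℝ) ^ (k₀ + k)
        = ((2 : ℝ) ^ (k₀ + k)) ^ κ := by
      rw [Real.rpow_sub_one (by positivity)]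
      field_simp
    rw [one_div_one_div, h1, ← h2]
    have := (hy0 k).ne'
    push_cast
    field_simp
    ring
  have hs : ∑' k, P (A (k₀ + k)) ≠ ∞ := by
    refine ne_top_of_le_ne_top (tsum_exp_scale_ne_top (F := F) (κ := κ) (l := l) hq
      (fun k => (hy k).1) (fun k => ?_) (fun k z hz hzy hyz => ?_) hI) (ENNReal.tsum_le_tsum hPA)
    · refine mul_scale_le_scale_succ hF hq (a := r / 8 * ((2 : ℝ) ^ (k₀ + (k + 1))) ^ (κ - 1))
        (by positivity) (hy0 k) (hy0 _) ?_ (hy (k + 1)).2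
      rw [(hy k).2, ← add_assoc, pow_succ, Real.mul_rpow (by positivity) (by positivity),
        show (1 - κ) = -(κ - 1) by ring, Real.rpow_neg (by positivity)]
      field_simp
    · have h := exponent_le hF hpos hκ hκ' hr8 (N := (2 : ℝ) ^ (k₀ + k)) (by positivity)
        (zero_lt_one.trans hq) hz hzy hyz (hy k).2
      refine (mul_le_mul_of_nonneg_left h hl0.le).trans ?_
      rw [← mul_assoc]
      exact mul_le_mul_of_nonneg_right hl (by have := hy0 k; positivity)
  filter_upwards [ae_eventually_notMem hs] with ω hω
  obtain ⟨K, hK⟩ := eventually_atTop.1 hω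
  refine eventually_atTop.2 ⟨k₀ + K, fun k hk n hn j hj => ?_⟩
  have h := hK (k - k₀) (by omega)
  rw [Nat.add_sub_cancel' (by omega)] at h
  by_contra! hlt
  exact h ⟨n, hn, j, hj, hlt⟩

end walk

/-! ### Borel–Cantelli for the steps `X⁻ - E X⁻`. -/

lemma exists_pow_two_gt {t : ℝ} (ht : 0 ≤ t) :
    ∃ J : ℕ, t < 2 ^ J ∧ ∑ k ∈ Finset.range J, (2 : ℝ) ^ k ≤ 2 * t := by
  rcases lt_or_ge t 1 with h | h
  · exact ⟨0, by simpa using h, by simpa using ht⟩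
  · obtain ⟨j, hj, hj'⟩ := exists_nat_pow_near h one_lt_two
    refine ⟨j + 1, hj', ?_⟩
    rw [geom_sum_eq (by norm_num)]
    rw [pow_succ]
    linarith

/-- Terms with `2^k ≤ t` sum to at most `2t`; beyond that they decay geometrically with ratio
`2^{1-p}`, which needs `p > 1`. -/
lemma tsum_pow_two_mul_min_le {p : ℝ} (hp : 1 < p) : ∃ C : ℝ, 0 ≤ C ∧ ∀ t : ℝ, 0 ≤ t →
    ∑' k : ℕ, ENNReal.ofReal (2 ^ k * min 1 ((t / 2 ^ k) ^ p)) ≤ ENNReal.ofReal (C * t) := by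
  set ρ : ℝ := (1 / 2) ^ (p - 1) with hρ
  have hρ0 : 0 ≤ ρ := by positivity
  have hρ1 : ρ < 1 := Real.rpow_lt_one (by norm_num) (by norm_num) (by linarith)
  have hρ2 : 0 < (1 - ρ)⁻¹ := inv_pos.2 (by linarith)
  refine ⟨2 + (1 - ρ)⁻¹, by positivity, fun t ht => ?_⟩
  obtain ⟨J, hJ, hsum⟩ := exists_pow_two_gt ht
  have hu : ∀ k : ℕ, 0 ≤ (2 : ℝ) ^ k * min 1 ((t / 2 ^ k) ^ p) := fun k => by positivity
  have h1 : ∑ k ∈ Finset.range J, ENNReal.ofReal ((2 : ℝ) ^ k * min 1 ((t / 2 ^ k) ^ p))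
      ≤ ENNReal.ofReal (2 * t) := by
    rw [← ENNReal.ofReal_sum_of_nonneg fun k _ => hu k]
    refine ENNReal.ofReal_le_ofReal (le_trans (Finset.sum_le_sum fun k _ => ?_) hsum)
    exact mul_le_of_le_one_right (by positivity) (min_le_left _ _)
  have h2 : ∀ i : ℕ, (2 : ℝ) ^ (i + J) * min 1 ((t / 2 ^ (i + J)) ^ p) ≤ t * ρ ^ i := by
    intro i
    have hN : (0 : ℝ) < 2 ^ (i + J) := by positivity
    have e : (t / 2 ^ (i + J)) ^ p = (t / 2 ^ (i + J)) * (t / 2 ^ (i + J)) ^ (p - 1) := by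
      rcases ht.eq_or_lt with rfl | ht0
      · rw [zero_div, zero_mul, Real.zero_rpow (by linarith)]
      · rw [Real.rpow_sub_one (by positivity)]
        field_simp
    calc (2 : ℝ) ^ (i + J) * min 1 ((t / 2 ^ (i + J)) ^ p)
        ≤ 2 ^ (i + J) * (t / 2 ^ (i + J)) ^ p :=
          mul_le_mul_of_nonneg_left (min_le_right _ _) hN.le
      _ = t * (t / 2 ^ (i + J)) ^ (p - 1) := by
          rw [e]
          field_simp
      _ ≤ t * ((1 / 2) ^ i) ^ (p - 1) := by
          refine mul_le_mul_of_nonneg_left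
            (Real.rpow_le_rpow (by positivity) ?_ (by linarith)) ht
          rw [div_le_iff₀ hN, one_div, inv_pow, pow_add, inv_mul_cancel_left₀ (by positivity)]
          exact hJ.le
      _ = t * ρ ^ i := by
          rw [hρ, ← Real.rpow_natCast, ← Real.rpow_natCast, ← Real.rpow_mul (by norm_num),
            ← Real.rpow_mul (by norm_num), mul_comm (i : ℝ)]
  have h3 : ∑' i : ℕ, ENNReal.ofReal ((2 : ℝ) ^ (i + J) * min 1 ((t / 2 ^ (i + J)) ^ p))
      ≤ ENNReal.ofReal (t * (1 - ρ)⁻¹) := by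
    rw [← tsum_geometric_of_lt_one hρ0 hρ1, ← tsum_mul_left, ENNReal.ofReal_tsum_of_nonneg
      (fun i => by positivity) ((summable_geometric_of_lt_one hρ0 hρ1).mul_left t)]
    exact ENNReal.tsum_le_tsum fun i => ENNReal.ofReal_le_ofReal (h2 i)
  have h0 := Summable.sum_add_tsum_nat_add' (k := J)
    (f := fun k : ℕ => ENNReal.ofReal ((2 : ℝ) ^ k * min 1 ((t / 2 ^ k) ^ p))) ENNReal.summable
  refine h0.symm.trans_le ((add_le_add h1 h3).trans ?_)
  rw [← ENNReal.ofReal_add (by positivity) (by positivity)]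
  exact ENNReal.ofReal_le_ofReal (by linarith)

/-- The negative part, replaced by `0` where it exceeds `b`. -/
noncomputable def truncNeg (b x : ℝ) : ℝ := if max (-x) 0 ≤ b then max (-x) 0 else 0

lemma measurable_truncNeg (b : ℝ) : Measurable (truncNeg b) :=
  Measurable.ite (measurableSet_le (by fun_prop) measurable_const) (by fun_prop) measurable_const

lemma truncNeg_nonneg (b x : ℝ) : 0 ≤ truncNeg b x := by
  rw [truncNeg]
  split_ifs
  exacts [le_max_right _ _, le_rfl]

lemma truncNeg_le (b x : ℝ) : truncNeg b x ≤ max (-x) 0 := by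
  rw [truncNeg]
  split_ifs
  exacts [le_rfl, le_max_right _ _]

lemma truncNeg_le_bound {b : ℝ} (hb : 0 ≤ b) (x : ℝ) : truncNeg b x ≤ b := by
  rw [truncNeg]
  split_ifs with h
  exacts [h, hb]

section walk

variable {Ω : Type*} [MeasurableSpace Ω] {P : Measure Ω} [IsProbabilityMeasure P]
  {X : ℕ → Ω → ℝ} {κ : ℝ}

/-- Either some `X⁻` exceeds `b` (union bound), or truncation changes no step and the quadratic
inequality applies. Both cases are gathered in `1 ∧ (x⁻ / b)²`. -/
lemma measure_negPart_increment_gt_le (hmeas : ∀ i, Measurable (X i))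
    (hindep : iIndepFun X P) (hident : ∀ i, IdentDistrib (X i) (X 0) P P)
    (hint : Integrable (X 0) P) {ε b : ℝ} (hε : 0 < ε) (hb : 0 < b) (M : ℕ) :
    P {ω | ∃ n ≤ M, ∃ j ≤ n, ε * b < ∑ i ∈ Finset.Ico j n,
        (max (-X i ω) 0 - ∫ x, max (-x) 0 ∂(P.map (X 0)))}
      ≤ ∫⁻ x, ENNReal.ofReal ((1 + (ε ^ 2)⁻¹) * (M * min 1 ((max (-x) 0 / b) ^ 2)))
        ∂(P.map (X 0)) := by
  set F := P.map (X 0) with hFdef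
  have : IsProbabilityMeasure F := Measure.isProbabilityMeasure_map (hmeas 0).aemeasurable
  have hF : Integrable (fun x : ℝ => x) F :=
    (integrable_map_measure (by fun_prop) (hmeas 0).aemeasurable).2 hint
  have hT := measurable_truncNeg b
  have hZ : Integrable (fun x : ℝ => max (-x) 0) F := hF.neg_part
  have hT2 : MemLp (truncNeg b) 2 F := MemLp.of_bound hT.aestronglyMeasurable b
    (ae_of_all _ fun x => by
      rw [Real.norm_of_nonneg (truncNeg_nonneg _ _)]
      exact truncNeg_le_bound hb.le x)
  have hm : ∫ x, truncNeg b x ∂F ≤ ∫ x, max (-x) 0 ∂F :=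
    integral_mono (hT2.integrable one_le_two) hZ (truncNeg_le b)
  set A : Set ℝ := {x | b < max (-x) 0} with hA
  have hAm : MeasurableSet A := measurableSet_lt measurable_const (by fun_prop)
  have h1 : P {ω | ∃ i < M, X i ω ∈ A} ≤ M * F A := by
    have e : {ω | ∃ i < M, X i ω ∈ A} = ⋃ i ∈ Finset.range M, X i ⁻¹' A := by
      ext ω
      simp
    rw [e]
    refine (measure_biUnion_finset_le _ _).trans (le_of_eq ?_)
    have : ∀ i, P (X i ⁻¹' A) = F A := fun i => by
      rw [← Measure.map_apply (hmeas i) hAm, (hident i).map_eq]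
    simp [this]
  have h2 := measure_sq_increment_gt_le hmeas hindep hident hT hT2
    (mul_pos hε hb).le M
  rw [mul_comm, ← ENNReal.le_div_iff_mul_le
    (.inl (ENNReal.ofReal_pos.2 (pow_pos (mul_pos hε hb) 2)).ne') (.inl ENNReal.ofReal_ne_top),
    ENNReal.div_eq_inv_mul, ← ENNReal.ofReal_inv_of_pos (pow_pos (mul_pos hε hb) 2),
    ← mul_assoc] at h2
  have hsub : {ω | ∃ n ≤ M, ∃ j ≤ n, ε * b < ∑ i ∈ Finset.Ico j n,
        (max (-X i ω) 0 - ∫ x, max (-x) 0 ∂F)} ⊆ {ω | ∃ i < M, X i ω ∈ A} ∪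
      {ω | ∃ n ≤ M, ∃ j ≤ n, ε * b < ∑ i ∈ Finset.Ico j n,
        (truncNeg b (X i ω) - ∫ x, truncNeg b x ∂F)} := by
    rintro ω ⟨n, hn, j, hj, h⟩
    by_cases hω : ∃ i < M, X i ω ∈ A
    · exact Or.inl hω
    · push Not at hω
      refine Or.inr ⟨n, hn, j, hj, h.trans_le (Finset.sum_le_sum fun i hi => ?_)⟩
      have : max (-X i ω) 0 ≤ b := not_lt.1 (hω i ((Finset.mem_Ico.1 hi).2.trans_le hn))
      rw [truncNeg, if_pos this]
      -- Centering by the smaller truncated mean only enlarges the increments.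
      linarith
  refine (measure_mono hsub).trans ((measure_union_le _ _).trans ((add_le_add h1 h2).trans ?_))
  rw [← lintegral_indicator_one hAm, ← lintegral_const_mul _ (measurable_one.indicator hAm),
    ← lintegral_const_mul _ (by fun_prop), ← lintegral_add_right _ (by fun_prop)]
  refine lintegral_mono fun x => ?_
  have hMr : (M : ℝ≥0∞) = ENNReal.ofReal M := (ENNReal.ofReal_natCast M).symm
  have hM0 : (0 : ℝ) ≤ M := M.cast_nonneg
  by_cases hx : x ∈ A
  · have hx' : b < max (-x) 0 := hx
    have h1 : (1 : ℝ) ≤ (max (-x) 0 / b) ^ 2 :=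
      one_le_pow₀ ((one_le_div hb).2 hx'.le)
    simp only [hx, Set.indicator_of_mem, Pi.one_apply, mul_one, truncNeg, not_le.2 hx', if_false,
      min_eq_left h1]
    rw [hMr]
    simp only [ne_eq, OfNat.ofNat_ne_zero, not_false_eq_true, zero_pow, ENNReal.ofReal_zero,
      mul_zero, add_zero]
    refine ENNReal.ofReal_le_ofReal (le_mul_of_one_le_left hM0 ?_)
    have : 0 < (ε ^ 2)⁻¹ := by positivity
    linarith
  · have hx' : max (-x) 0 ≤ b := not_lt.1 hx
    have h1 : (max (-x) 0 / b) ^ 2 ≤ 1 :=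
      pow_le_one₀ (div_nonneg (le_max_right _ _) hb.le) ((div_le_one hb).2 hx')
    simp only [hx, Set.indicator_of_notMem, not_false_eq_true, mul_zero, zero_add, truncNeg, hx',
      if_true, min_eq_right h1]
    rw [hMr, ← ENNReal.ofReal_mul (by positivity), ← ENNReal.ofReal_mul (by positivity)]
    refine ENNReal.ofReal_le_ofReal ?_
    have e : ((ε * b) ^ 2)⁻¹ * M * max (-x) 0 ^ 2
        = (ε ^ 2)⁻¹ * (M * (max (-x) 0 / b) ^ 2) := by
      field_simp
    rw [e]
    refine mul_le_mul_of_nonneg_right (by linarith) (by positivity)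

/-- Almost sure control, along dyadic times, of the increments of the walk with steps
`X⁻ - E X⁻`, when `E (X⁻) ^ (1 / κ) < ∞`. -/
theorem ae_eventually_negPart_increment_le (hmeas : ∀ i, Measurable (X i))
    (hindep : iIndepFun X P) (hident : ∀ i, IdentDistrib (X i) (X 0) P P)
    (hint : Integrable (X 0) P) (hκ : 1 / 2 < κ)
    (hneg : ∫⁻ ω, ENNReal.ofReal ((max (-X 0 ω) 0) ^ (1 / κ)) ∂P < ∞) {ε : ℝ} (hε : 0 < ε) :
    ∀ᵐ ω ∂P, ∀ᶠ k : ℕ in atTop, ∀ n ≤ 2 ^ (k + 1), ∀ j ≤ n,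
      ∑ i ∈ Finset.Ico j n, (max (-X i ω) 0 - ∫ x, max (-x) 0 ∂(P.map (X 0)))
        ≤ ε * ((2 : ℝ) ^ k) ^ κ := by
  set F := P.map (X 0) with hFdef
  have hκ0 : 0 < κ := by linarith
  -- With `t = (x⁻)^{1/κ}`, `(x⁻ / 2^{kκ})²` is `(t / 2^k)^{2κ}`; `κ > 1/2` is exactly `2κ > 1`.
  obtain ⟨C, hC, hsum⟩ := tsum_pow_two_mul_min_le (p := 2 * κ) (by linarith)
  set D : ℝ := 2 * (1 + (ε ^ 2)⁻¹) with hD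
  have hD0 : 0 ≤ D := by positivity
  set B : ℕ → Set Ω := fun k => {ω | ∃ n ≤ 2 ^ (k + 1), ∃ j ≤ n, ε * ((2 : ℝ) ^ k) ^ κ <
    ∑ i ∈ Finset.Ico j n, (max (-X i ω) 0 - ∫ x, max (-x) 0 ∂F)}
  have hB : ∀ k, P (B k) ≤ ∫⁻ x, ENNReal.ofReal D *
      ENNReal.ofReal (2 ^ k * min 1 ((max (-x) 0 ^ (1 / κ) / 2 ^ k) ^ (2 * κ))) ∂F := by
    intro k
    refine (measure_negPart_increment_gt_le hmeas hindep hident hint hε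
      (b := ((2 : ℝ) ^ k) ^ κ) (by positivity) _).trans_eq ?_
    refine lintegral_congr fun x => ?_
    have hx : 0 ≤ max (-x) 0 := le_max_right _ _
    have e : (max (-x) 0 ^ (1 / κ) / 2 ^ k) ^ (2 * κ) = (max (-x) 0 / ((2 : ℝ) ^ k) ^ κ) ^ 2 := by
      rw [mul_comm 2 κ, Real.rpow_mul (by positivity), Real.div_rpow (by positivity)
        (by positivity), ← Real.rpow_mul hx, one_div_mul_cancel hκ0.ne', Real.rpow_one]
      exact Real.rpow_two _
    rw [e, ← ENNReal.ofReal_mul hD0]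
    congr 1
    rw [hD]
    push_cast
    ring
  have hs : ∑' k, P (B k) ≠ ∞ := by
    refine ne_top_of_le_ne_top ?_ (ENNReal.tsum_le_tsum hB)
    rw [← lintegral_tsum fun k => by fun_prop]
    simp_rw [ENNReal.tsum_mul_left]
    refine ne_top_of_le_ne_top ?_ (lintegral_mono fun x =>
      mul_le_mul_right (hsum (max (-x) 0 ^ (1 / κ)) (by positivity)) _)
    simp_rw [ENNReal.ofReal_mul hC]
    rw [lintegral_const_mul _ (by fun_prop), lintegral_const_mul _ (by fun_prop),
      hFdef, lintegral_map (by fun_prop) (hmeas 0)]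
    exact ENNReal.mul_ne_top ENNReal.ofReal_ne_top (ENNReal.mul_ne_top ENNReal.ofReal_ne_top
      hneg.ne)
  filter_upwards [ae_eventually_notMem hs] with ω hω
  filter_upwards [hω] with k hk n hn j hj
  by_contra! hlt
  exact hk ⟨n, hn, j, hj, hlt⟩

end walk

/-! ### The constant `r_0`. -/

/-- The right side is the largest `λ` admissible for the budget `r/2`. The inequality must be
strict, since the infimum `λ*` need not be attained; the constant 9, where 8 would give equality at
best in this estimate, supplies this. -/
lemma lt_of_constant_mul_rpow_le {κ r Λ : ℝ} (hκ : 1 / 2 < κ) (hκ' : κ < 1) (hr : 0 < r)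
    (h : 9 * (2 : ℝ) ^ κ * (6 * Λ * (2 : ℝ) ^ κ) ^ (1 - κ) ≤ r) :
    Λ < r / 2 / 2 / ((2 : ℝ) ^ (1 - κ) * (r / 2 / 8) ^ (-(κ / (1 - κ)))) := by
  have hκ1 : 0 < 1 - κ := by linarith
  set a := κ / (1 - κ) with ha
  have haκ : a * (1 - κ) = κ := div_mul_cancel₀ _ hκ1.ne'
  set L := r / 2 / 2 / ((2 : ℝ) ^ (1 - κ) * (r / 2 / 8) ^ (-a)) with hL
  have hL0 : 0 < L := by positivity
  have eL : 4 * L * (2 : ℝ) ^ κ = r * (r / 16) ^ a * (2 : ℝ) ^ (2 * κ - 1) := by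
    have e1 : (2 : ℝ) ^ (2 * κ - 1) = (2 : ℝ) ^ κ / (2 : ℝ) ^ (1 - κ) := by
      rw [← Real.rpow_sub two_pos]
      congr 1
      ring
    have e2 : r / 2 / 8 = r / 16 := by ring
    rw [hL, e1, e2, Real.rpow_neg (by positivity)]
    field_simp
    ring
  have ep : (r * (r / 16) ^ a * (2 : ℝ) ^ (2 * κ - 1)) ^ (1 - κ)
      = r * (2 : ℝ) ^ (-4 * κ + (2 * κ - 1) * (1 - κ)) := by
    rw [Real.mul_rpow (by positivity) (by positivity), Real.mul_rpow hr.le (by positivity),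
      ← Real.rpow_mul (by positivity), ← Real.rpow_mul two_pos.le, haκ,
      Real.div_rpow hr.le (by norm_num), show (16 : ℝ) = 2 ^ (4 : ℝ) by norm_num,
      ← Real.rpow_mul two_pos.le, Real.rpow_add two_pos, Real.rpow_sub hr, Real.rpow_one,
      neg_mul, Real.rpow_neg two_pos.le]
    have := (Real.rpow_pos_of_pos hr κ).ne'
    field_simp
  by_contra! hle
  have h1 : r * (2 : ℝ) ^ (-4 * κ + (2 * κ - 1) * (1 - κ))
      ≤ (6 * Λ * (2 : ℝ) ^ κ) ^ (1 - κ) := by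
    rw [← ep, ← eL]
    gcongr
    norm_num
  -- The total exponent of 2 is `(1 - κ)(2 + 2κ)`, hence nonnegative.
  have h2 : (1 : ℝ) ≤ 8 * (2 : ℝ) ^ κ * (2 : ℝ) ^ (-4 * κ + (2 * κ - 1) * (1 - κ)) := by
    rw [show (8 : ℝ) = 2 ^ (3 : ℝ) by norm_num, ← Real.rpow_add two_pos, ← Real.rpow_add two_pos]
    exact Real.one_le_rpow one_le_two (by nlinarith)
  have h3 : 0 < (2 : ℝ) ^ κ * (r * (2 : ℝ) ^ (-4 * κ + (2 * κ - 1) * (1 - κ))) := by positivity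
  have h4 : (2 : ℝ) ^ κ * (r * (2 : ℝ) ^ (-4 * κ + (2 * κ - 1) * (1 - κ)))
      ≤ (2 : ℝ) ^ κ * (6 * Λ * (2 : ℝ) ^ κ) ^ (1 - κ) :=
    mul_le_mul_of_nonneg_left h1 (by positivity)
  nlinarith

lemma exists_finite_I {F : Measure ℝ} {κ r : ℝ} (hκ : 1 / 2 < κ) (hκ' : κ < 1) (hr : 0 < r)
    (hlam : lambdaStar F κ < ∞) (h : r0 F κ ≤ r) : ∃ l, 0 < l ∧ I F κ l < ∞ ∧
      l * ((2 : ℝ) ^ (1 - κ) * (r / 2 / 8) ^ (-(κ / (1 - κ)))) ≤ r / 2 / 2 := by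
  have h1 := lt_of_constant_mul_rpow_le hκ hκ' hr h
  have h2 := (ENNReal.lt_ofReal_iff_toReal_lt hlam.ne).2 h1
  rw [lambdaStar] at h2
  obtain ⟨l, hl⟩ := iInf_lt_iff.1 h2
  obtain ⟨⟨hl0, hlI⟩, hl⟩ := iInf_lt_iff.1 hl
  refine ⟨l, hl0, hlI, ?_⟩
  have h3 := (ENNReal.ofReal_lt_ofReal_iff_of_nonneg hl0.le).1 hl
  exact ((lt_div_iff₀ (by positivity)).1 h3).le

/-! ### Passing from dyadic increments to `R` and `τ`. -/

section path

variable {Ω : Type*} {X : ℕ → Ω → ℝ}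

lemma R_le_iff {n : ℕ} {ω : Ω} {c : ℝ} :
    R X n ω ≤ c ↔ ∀ j ≤ n, ∑ i ∈ Finset.Ico j n, -X i ω ≤ c := by
  rw [R, sub_le_iff_le_add, Finset.sup'_le_iff]
  refine forall_congr' fun j => ?_
  rw [Finset.mem_range, Nat.lt_succ_iff]
  refine forall_congr' fun hj => ?_
  rw [Finset.sum_neg_distrib, Finset.sum_Ico_eq_sub _ hj, S, S]
  constructor <;> intro h <;> linarith

lemma tau_eq_top_iff {κ r : ℝ} {ω : Ω} :
    tau X κ r ω = ⊤ ↔ ∀ n : ℕ, 1 ≤ n → R X n ω ≤ r * (n : ℝ) ^ κ := by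
  simp [tau, iInf_eq_top]

end path

section walk

variable {Ω : Type*} [MeasurableSpace Ω] {P : Measure Ω} [IsProbabilityMeasure P]
  {X : ℕ → Ω → ℝ} {κ : ℝ}

/-- The infinite moment of `X⁺` enters only here: it excludes `X ≤ 0` almost surely, giving `W > 0`
and positive steps with positive probability. -/
lemma map_Ioi_ne_zero {Y : Ω → ℝ} (hY : Measurable Y) (hκ : 0 < κ)
    (hpos : ∫⁻ ω, ENNReal.ofReal ((max (Y ω) 0) ^ (1 / κ)) ∂P = ∞) :
    P.map Y (Set.Ioi 0) ≠ 0 := by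
  intro h
  rw [Measure.map_apply hY measurableSet_Ioi] at h
  have h' : ∀ᵐ ω ∂P, ω ∉ Y ⁻¹' Set.Ioi 0 := measure_eq_zero_iff_ae_notMem.1 h
  rw [lintegral_congr_ae (g := fun _ => 0)] at hpos
  · simp at hpos
  · filter_upwards [h'] with ω hω
    have : Y ω ≤ 0 := not_lt.1 hω
    rw [max_eq_right this, Real.zero_rpow (by positivity), ENNReal.ofReal_zero]

/-- The reflected walk is eventually below `r n ^ κ` for every positive `r ≥ r_0`. -/
theorem ae_eventually_R_le (hmeas : ∀ i, Measurable (X i))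
    (hindep : iIndepFun X P) (hident : ∀ i, IdentDistrib (X i) (X 0) P P)
    (hκ : 1 / 2 < κ) (hκ' : κ < 1)
    (hint : Integrable (X 0) P) (hmean : ∫ ω, X 0 ω ∂P = 0)
    (hneg : ∫⁻ ω, ENNReal.ofReal ((max (-X 0 ω) 0) ^ (1 / κ)) ∂P < ∞)
    (hpos : ∫⁻ ω, ENNReal.ofReal ((max (X 0 ω) 0) ^ (1 / κ)) ∂P = ∞)
    (hlam : lambdaStar (P.map (X 0)) κ < ∞) {r : ℝ} (hr : 0 < r)
    (hr0 : r0 (P.map (X 0)) κ ≤ r) :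
    ∀ᵐ ω ∂P, ∀ᶠ n : ℕ in atTop, R X n ω ≤ r * (n : ℝ) ^ κ := by
  obtain ⟨l, hl0, hI, hl⟩ := exists_finite_I hκ hκ' hr hlam hr0
  have hκ0 : 0 < κ := by linarith
  have hF : Integrable (fun x : ℝ => x) (P.map (X 0)) :=
    (integrable_map_measure (by fun_prop) (hmeas 0).aemeasurable).2 hint
  have hm : ∫ x, max x 0 ∂(P.map (X 0)) = ∫ x, max (-x) 0 ∂(P.map (X 0)) := by
    rw [← sub_eq_zero, ← integral_sub hF.pos_part hF.neg_part]
    simp_rw [max_zero_sub_max_neg_zero_eq_self]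
    rw [integral_map (hmeas 0).aemeasurable (by fun_prop)]
    exact hmean
  filter_upwards [ae_eventually_posPart_increment_le hmeas hindep hident hint
      (map_Ioi_ne_zero (hmeas 0) hκ0 hpos) hκ hκ' (half_pos hr) hl0 hI hl,
    ae_eventually_negPart_increment_le hmeas hindep hident hint hκ hneg (half_pos hr)]
    with ω h1 h2
  obtain ⟨K, hK⟩ := eventually_atTop.1 (h1.and h2)
  refine eventually_atTop.2 ⟨2 ^ K, fun n hn => R_le_iff.2 fun j hj => ?_⟩
  have hn0 : n ≠ 0 := (lt_of_lt_of_le (by positivity) hn).ne'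
  -- For `2^k ≤ n < 2^{k+1}`, the estimate up to time `2^{k+1}` covers `n`, while its threshold uses
  -- `2^k ≤ n`.
  obtain ⟨h1, h2⟩ := hK (Nat.log 2 n) ((Nat.le_log_iff_pow_le one_lt_two hn0).2 hn)
  have hlt : n ≤ 2 ^ (Nat.log 2 n + 1) := (Nat.lt_pow_succ_log_self one_lt_two n).le
  have hle : ((2 : ℝ) ^ Nat.log 2 n) ^ κ ≤ (n : ℝ) ^ κ :=
    Real.rpow_le_rpow (by positivity) (by exact_mod_cast Nat.pow_log_le_self 2 hn0) hκ0.le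
  have e : ∑ i ∈ Finset.Ico j n, -X i ω
      = ∑ i ∈ Finset.Ico j n, (∫ x, max x 0 ∂(P.map (X 0)) - max (X i ω) 0)
        + ∑ i ∈ Finset.Ico j n, (max (-X i ω) 0 - ∫ x, max (-x) 0 ∂(P.map (X 0))) := by
    rw [← Finset.sum_add_distrib]
    refine Finset.sum_congr rfl fun i _ => ?_
    have := max_zero_sub_max_neg_zero_eq_self (X i ω)
    rw [hm]
    linarith
  rw [e]
  have := mul_le_mul_of_nonneg_left hle hr.le
  linarith [h1 n hlt j hj, h2 n hlt j hj]

lemma measurable_iSup_comap {Ω : Type*} (X : ℕ → Ω → ℝ) {T : Set ℕ} {i : ℕ} (hi : i ∈ T) :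
    Measurable[⨆ i ∈ T, MeasurableSpace.comap (X i) inferInstance] (X i) := by
  rw [measurable_iff_comap_le]
  exact le_iSup₂_of_le (f := fun i (_ : i ∈ T) =>
    MeasurableSpace.comap (X i) inferInstance) i hi le_rfl

lemma measurableSet_iSup_comap_biInter {Ω : Type*} {X : ℕ → Ω → ℝ} (m : ℕ) :
    MeasurableSet[⨆ i ∈ Set.Iio m, MeasurableSpace.comap (X i) inferInstance]
      (⋂ i ∈ Finset.range m, X i ⁻¹' Set.Ioi 0) := by
  let _ : MeasurableSpace Ω := ⨆ i ∈ Set.Iio m, MeasurableSpace.comap (X i) inferInstance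
  exact Finset.measurableSet_biInter _ fun i hi =>
    measurable_iSup_comap X (T := Set.Iio m) (Finset.mem_range.1 hi) measurableSet_Ioi

lemma measurableSet_iSup_comap_increments {Ω : Type*} {X : ℕ → Ω → ℝ} (m : ℕ) (c : ℕ → ℝ) :
    MeasurableSet[⨆ i ∈ Set.Ici m, MeasurableSpace.comap (X i) inferInstance]
      {ω | ∀ n, ∀ j, m ≤ j → j ≤ n → ∑ i ∈ Finset.Ico j n, -X i ω ≤ c n} := by
  let _ : MeasurableSpace Ω := ⨆ i ∈ Set.Ici m, MeasurableSpace.comap (X i) inferInstance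
  simp only [Set.ofPred_forall]
  refine MeasurableSet.iInter fun n => MeasurableSet.iInter fun j =>
    MeasurableSet.iInter fun hj => MeasurableSet.iInter fun _ => ?_
  refine measurableSet_le ?_ measurable_const
  exact Finset.measurable_fun_sum _ fun i hi =>
    (measurable_iSup_comap X (T := Set.Ici m) (hj.trans (Finset.mem_Ico.1 hi).1)).neg

/-- If the reflected walk is eventually below `r n ^ κ`, then with positive probability it
is so at all times: it stays at `0` for a long time with positive probability, and is
restarted afterwards. -/
theorem measure_tau_eq_top_pos (hmeas : ∀ i, Measurable (X i))
    (hindep : iIndepFun X P) (hident : ∀ i, IdentDistrib (X i) (X 0) P P)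
    (hpos : P.map (X 0) (Set.Ioi 0) ≠ 0) {r : ℝ} (hr : 0 ≤ r)
    (hev : ∀ᵐ ω ∂P, ∀ᶠ n : ℕ in atTop, R X n ω ≤ r * (n : ℝ) ^ κ) :
    0 < P {ω | tau X κ r ω = ⊤} := by
  set E : ℕ → Set Ω := fun m => {ω | ∀ n, ∀ j, m ≤ j → j ≤ n →
    ∑ i ∈ Finset.Ico j n, -X i ω ≤ r * (n : ℝ) ^ κ} with hE
  set A : ℕ → Set Ω := fun m => ⋂ i ∈ Finset.range m, X i ⁻¹' Set.Ioi 0 with hA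
  -- Almost every path lies in some `E m`, so the countable union cannot consist of null sets.
  obtain ⟨m, hm⟩ : ∃ m, P (E m) ≠ 0 := by
    by_contra! h
    have h0 : P (⋃ m, E m) = 0 := measure_iUnion_null h
    have h1 : ∀ᵐ ω ∂P, ω ∈ ⋃ m, E m := by
      filter_upwards [hev] with ω hω
      obtain ⟨m, hm⟩ := eventually_atTop.1 hω
      exact Set.mem_iUnion.2 ⟨m, fun n j hj hjn => R_le_iff.1 (hm n (hj.trans hjn)) j hjn⟩
    have h2 : ∀ᵐ ω ∂P, ω ∉ ⋃ m, E m := measure_eq_zero_iff_ae_notMem.1 h0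
    obtain ⟨ω, hω, hω'⟩ := (h1.and h2).exists
    exact hω' hω
  have hAm : P (A m) ≠ 0 := by
    rw [hA, hindep.measure_inter_preimage_eq_mul _ fun _ _ => measurableSet_Ioi,
      Finset.prod_ne_zero_iff]
    intro i _
    rwa [← Measure.map_apply (hmeas i) measurableSet_Ioi, (hident i).map_eq]
  have hind := indep_iSup_of_disjoint (fun i => (hmeas i).comap_le) hindep
    (S := Set.Iio m) (T := Set.Ici m) (Set.Iio_disjoint_Ici le_rfl)
  have hAE : P (A m ∩ E m) = P (A m) * P (E m) :=
    (Indep_iff _ _ _).1 hind _ _ (measurableSet_iSup_comap_biInter m)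
      (measurableSet_iSup_comap_increments m _)
  refine (pos_iff_ne_zero.2 (hAE ▸ mul_ne_zero hAm hm : P (A m ∩ E m) ≠ 0)).trans_le
    (measure_mono ?_)
  rintro ω ⟨hωA, hωE⟩
  have hp : ∀ i < m, 0 < X i ω := fun i hi =>
    Set.mem_iInter₂.1 hωA i (Finset.mem_range.2 hi)
  have hneg : ∀ j n, n ≤ m → ∑ i ∈ Finset.Ico j n, -X i ω ≤ 0 := fun j n hn =>
    Finset.sum_nonpos fun i hi =>
      neg_nonpos.2 (hp i ((Finset.mem_Ico.1 hi).2.trans_le hn)).le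
  refine tau_eq_top_iff.2 fun n _ => R_le_iff.2 fun j hj => ?_
  have hc : 0 ≤ r * (n : ℝ) ^ κ := by positivity
  rcases le_total m j with hmj | hmj
  · exact hωE n j hmj hj
  · rcases le_total n m with hnm | hnm
    · exact (hneg j n hnm).trans hc
    · rw [← Finset.sum_Ico_consecutive _ hmj hnm]
      linarith [hneg j m le_rfl, hωE n m le_rfl hnm]

end walk

lemma limsup_coe_div_le {a b : ℕ → ℝ} {c : ℝ} (hb : ∀ n, 1 ≤ n → 0 < b n)
    (h : ∀ k : ℕ, ∀ᶠ n in atTop, a n ≤ (c + 1 / ((k : ℝ) + 1)) * b n) :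
    limsup (fun n => ((a n / b n : ℝ) : EReal)) atTop ≤ (c : EReal) := by
  refine EReal.le_of_forall_lt_iff_le.1 fun z hz => ?_
  obtain ⟨k, hk⟩ := exists_nat_one_div_lt (sub_pos.2 (EReal.coe_lt_coe_iff.1 hz))
  refine limsup_le_of_le (h := ?_)
  filter_upwards [h k, eventually_ge_atTop 1] with n hn hn1
  refine EReal.coe_le_coe_iff.2 (((div_le_iff₀ (hb n hn1)).2 hn).trans ?_)
  linarith

end ReflectedWalk

theorem lemma3p4 {Ω : Type*} [MeasurableSpace Ω] (P : Measure Ω) [IsProbabilityMeasure P]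
    (X : ℕ → Ω → ℝ) (hmeas : ∀ i, Measurable (X i))
    (hindep : iIndepFun X P) (hident : ∀ i, IdentDistrib (X i) (X 0) P P)
    (κ : ℝ) (hκ : 1 / 2 < κ) (hκ' : κ < 1)
    (hint : Integrable (X 0) P) (hmean : ∫ ω, X 0 ω ∂P = 0)
    (hneg : ∫⁻ ω, ENNReal.ofReal ((max (-X 0 ω) 0) ^ (1 / κ)) ∂P < ∞)
    (hpos : ∫⁻ ω, ENNReal.ofReal ((max (X 0 ω) 0) ^ (1 / κ)) ∂P = ∞)
    (hlam : ReflectedWalk.lambdaStar (P.map (X 0)) κ < ∞) :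
    (∀ᵐ ω ∂P,
      limsup (fun n : ℕ => ((ReflectedWalk.R X n ω / (n : ℝ) ^ κ : ℝ) : EReal)) atTop
        ≤ ((ReflectedWalk.r0 (P.map (X 0)) κ : ℝ) : EReal)) ∧
    ∀ r : ℝ, 0 < r → ReflectedWalk.r0 (P.map (X 0)) κ ≤ r →
      0 < P {ω | ReflectedWalk.tau X κ r ω = ⊤} := by
  have main := fun (r : ℝ) (hr : 0 < r) (hr0 : ReflectedWalk.r0 (P.map (X 0)) κ ≤ r) =>
    ReflectedWalk.ae_eventually_R_le hmeas hindep hident hκ hκ' hint hmean hneg hpos hlam hr hr0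
  have h0 : 0 ≤ ReflectedWalk.r0 (P.map (X 0)) κ := by
    unfold ReflectedWalk.r0
    positivity
  refine ⟨?_, fun r hr hr0 => ReflectedWalk.measure_tau_eq_top_pos hmeas hindep hident
    (ReflectedWalk.map_Ioi_ne_zero (hmeas 0) (by linarith) hpos) hr.le (main r hr hr0)⟩
  have hk : ∀ k : ℕ, 0 < 1 / ((k : ℝ) + 1) := fun k => Nat.one_div_pos_of_nat
  filter_upwards [ae_all_iff.2 fun k : ℕ => main
    (ReflectedWalk.r0 (P.map (X 0)) κ + 1 / ((k : ℝ) + 1)) (by linarith [hk k])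
    (by linarith [hk k])] with ω hω
  exact ReflectedWalk.limsup_coe_div_le
    (fun n hn => Real.rpow_pos_of_pos (by exact_mod_cast hn) κ) hω
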